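/- Let $G$ be a real semisimple Lie group with Lie algebra $\mathfrak g$ and Killing form $B$, let $P\subset G$ be a parabolic subgroup (a closed subgroup whose Lie algebra $\mathfrak p\subset\mathfrak g$ is a parabolic subalgebra), and let $(p:\mathcal G\to M,\omega)$ be a parabolic geometry of type $(G,P)$, i.e. a smooth principal $P$-bundle over a smooth (Hausdorff, second countable) manifold $M$ together with a Cartan connection $\omega\in\Omega^1(\mathcal G,\mathfrak g)$. For a finite-dimensional smooth real representation $W$ of $P$ let $WM=\mathcal G\times_P W$ be the induced natural vector bundle, whose smooth sections are identified with the smooth functions $f:\mathcal G\to W$ satisfying $f(u\cdot h)=h^{-1}\cdot f(u)$ for $u\in\mathcal G$, $h\in P$. Let $\mathcal AM=\mathcal G\times_P\mathfrak g$ be the adjoint tractor bundle, let $D:\Gamma(WM)\to\Gamma(\mathcal A^*M\otimes WM)$ be the fundamental derivative, given on equivariant functions by $(Df)(u)(X)=(\omega^{-1}(X)\cdot f)(u)$ for $X\in\mathfrak g$, and let $$\mathcal C_W=(B\otimes\mathrm{id})\circ D^2:\Gamma(WM)\to\Gamma(WM)$$ be the curved Casimir operator, where $B$ is regarded as a bilinear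 form on $\mathfrak g^*$ via the isomorphism $\mathfrak g\cong\mathfrak g^*$ it induces; thus $\mathcal C_W f=\sum_\ell (D^2f)(\xi^\ell,\xi_\ell)$ for any basis $\{\xi^\ell\}$ of $\mathfrak g$ with $B$-dual basis $\{\xi_\ell\}$. 1. Let $W,W'$ be finite-dimensional smooth representations of $P$, let $\Phi:W\to W'$ be a $P$-equivariant linear map, and denote also by $\Phi$ the induced bundle map $WM\to W'M$. Then $\mathcal C_{W'}(\Phi(\sigma))=\Phi(\mathcal C_W(\sigma))$ for all $\sigma\in\Gamma(WM)$. 2. Let $W_0\subset W$ be a $P$-invariant subspace. If $\sigma\in\Gamma(WM)$ has values in the natural subbundle $W_0M=\mathcal G\times_P W_0\subset WM$, then so does $\mathcal C_W(\sigma)$. Moreover such a $\sigma$ is a smooth section of $W_0M$ in a unique way, and $\mathcal C_W(\sigma)=\mathcal C_{W_0}(\sigma)$. 3. Let $W_0\subset W$ be a $P$-invariant subspace and $\pi:WM\to(W/W_0)M$ the projection to the natural quotient bundle. There is exactly one operator $T$ on $\Gamma((W/W_0)M)$ such that $T(\pi(\sigma))=\pi(\mathcal C_W(\sigma))$ for all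 $\sigma\in\Gamma(WM)$, namely $T=\mathcal C_{W/W_0}$. -/

import Mathlib

open scoped Manifold ContDiff

noncomputable section

namespace CurvedCasimir

open Set Bundle

instance completeSpace_of_finiteDimensional {E : Type*} [NormedAddCommGroup E] [NormedSpace ℝ E]
    [FiniteDimensional ℝ E] : CompleteSpace E :=
  FiniteDimensional.complete ℝ E

section LieGroups

variable {EG : Type*} [NormedAddCommGroup EG] [NormedSpace ℝ EG]
  {G : Type*} [TopologicalSpace G] [ChartedSpace EG G] [Group G]

instance lieGroup_minSmoothness [LieGroup 𝓘(ℝ, EG) ∞ G] :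
    LieGroup 𝓘(ℝ, EG) (minSmoothness ℝ 3) G := by
  rw [minSmoothness_of_isRCLikeNormedField]
  infer_instance

variable (EG G) in
/-- The Lie algebra `𝔤 = T₁G` of the Lie group `G`. As a vector space, it is by definition the
model vector space `EG` of the manifold `G`. -/
abbrev LieAlg : Type _ := GroupLieAlgebra 𝓘(ℝ, EG) G

variable (EG) in
/-- The adjoint action `Ad(g) : 𝔤 → 𝔤`, the derivative of the conjugation `x ↦ g x g⁻¹` at `1`. -/
def Ad (g : G) : EG →L[ℝ] EG :=
  mfderiv 𝓘(ℝ, EG) 𝓘(ℝ, EG) (fun x : G => g * x * g⁻¹) 1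

lemma Ad_one : Ad EG (1 : G) = ContinuousLinearMap.id ℝ EG := by
  have : (fun x : G => (1 : G) * x * 1⁻¹) = id := by ext x; simp
  unfold Ad
  rw [this]
  exact mfderiv_id

variable [LieGroup 𝓘(ℝ, EG) ∞ G]

lemma contMDiff_conj (g : G) :
    ContMDiff 𝓘(ℝ, EG) 𝓘(ℝ, EG) ∞ (fun x : G => g * x * g⁻¹) :=
  (contMDiff_mul_right (I := 𝓘(ℝ, EG)) (n := ∞) (a := g⁻¹)).comp
    (contMDiff_mul_left (I := 𝓘(ℝ, EG)) (n := ∞) (a := g))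

lemma mdifferentiable_conj (g : G) :
    MDifferentiable 𝓘(ℝ, EG) 𝓘(ℝ, EG) (fun x : G => g * x * g⁻¹) :=
  (contMDiff_conj g).mdifferentiable (by simp)

lemma Ad_mul (g h : G) : Ad EG (g * h) = (Ad EG g).comp (Ad EG h) := by
  have : (fun x : G => (g * h) * x * (g * h)⁻¹) =
      (fun x : G => g * x * g⁻¹) ∘ (fun x : G => h * x * h⁻¹) := by
    ext x; simp [mul_assoc]
  unfold Ad
  rw [this, mfderiv_comp (I' := 𝓘(ℝ, EG)) _ (mdifferentiable_conj g _) (mdifferentiable_conj h _)]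
  have h1 : h * 1 * h⁻¹ = 1 := by simp
  rw [h1]
  rfl

lemma Ad_inv_comp (g : G) : (Ad EG g⁻¹).comp (Ad EG g) = ContinuousLinearMap.id ℝ EG := by
  rw [← Ad_mul, inv_mul_cancel, Ad_one]

lemma Ad_comp_inv (g : G) : (Ad EG g).comp (Ad EG g⁻¹) = ContinuousLinearMap.id ℝ EG := by
  rw [← Ad_mul, mul_inv_cancel, Ad_one]

lemma mfderiv_conj_mulInvariant (g x : G) (v : LieAlg EG G) :
    mfderiv 𝓘(ℝ, EG) 𝓘(ℝ, EG) (fun x : G => g * x * g⁻¹) x (mulInvariantVectorField v x) =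
      mulInvariantVectorField (I := 𝓘(ℝ, EG)) (G := G) (Ad EG g v) (g * x * g⁻¹) := by
  have hl : ∀ a b : G, MDifferentiableAt 𝓘(ℝ, EG) 𝓘(ℝ, EG) (fun x : G => a * x) b := fun a b =>
    (contMDiff_mul_left (I := 𝓘(ℝ, EG)) (n := ∞) (a := a)).mdifferentiable (by simp) b
  have e : (fun y : G => g * y * g⁻¹) ∘ (fun y => x * y) =
      (fun y => (g * x * g⁻¹) * y) ∘ (fun y : G => g * y * g⁻¹) := by
    ext y; simp [mul_assoc]
  have h1 := mfderiv_comp (I := 𝓘(ℝ, EG)) (I' := 𝓘(ℝ, EG)) (I'' := 𝓘(ℝ, EG)) (1 : G)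
    (mdifferentiable_conj g (x * 1)) (hl x 1)
  have h2 := mfderiv_comp (I := 𝓘(ℝ, EG)) (I' := 𝓘(ℝ, EG)) (I'' := 𝓘(ℝ, EG)) (1 : G)
    (hl (g * x * g⁻¹) (g * 1 * g⁻¹)) (mdifferentiable_conj g 1)
  rw [e, h2] at h1
  have h3 := congrArg (fun L : EG →L[ℝ] EG => L v) h1
  have hx : x * 1 = x := mul_one x
  have hg : g * 1 * g⁻¹ = 1 := by simp
  rw [hx, hg] at h3
  exact h3.symm

lemma Ad_lie [FiniteDimensional ℝ EG] (g : G) (v w : LieAlg EG G) :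
    (show LieAlg EG G from Ad EG g (⁅v, w⁆ : LieAlg EG G)) =
      ⁅(show LieAlg EG G from Ad EG g v), (show LieAlg EG G from Ad EG g w)⁆ := by
  have key : ∀ v : LieAlg EG G, VectorField.mpullback 𝓘(ℝ, EG) 𝓘(ℝ, EG)
      (fun x : G => g * x * g⁻¹)
      (mulInvariantVectorField (I := 𝓘(ℝ, EG)) (G := G) (Ad EG g v)) =
        mulInvariantVectorField v := by
    intro v
    ext x
    have e1 : (fun y : G => g⁻¹ * y * g⁻¹⁻¹) ∘ (fun y : G => g * y * g⁻¹) = id := by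
      ext y; simp [mul_assoc]
    have e2 : (fun y : G => g * y * g⁻¹) ∘ (fun y : G => g⁻¹ * y * g⁻¹⁻¹) = id := by
      ext y; simp [mul_assoc]
    have h1 := mfderiv_comp (I := 𝓘(ℝ, EG)) (I' := 𝓘(ℝ, EG)) (I'' := 𝓘(ℝ, EG)) x
      (mdifferentiable_conj g⁻¹ (g * x * g⁻¹)) (mdifferentiable_conj g x)
    have h2 := mfderiv_comp (I := 𝓘(ℝ, EG)) (I' := 𝓘(ℝ, EG)) (I'' := 𝓘(ℝ, EG)) (g * x * g⁻¹)
      (mdifferentiable_conj g (g⁻¹ * (g * x * g⁻¹) * g⁻¹⁻¹)) (mdifferentiable_conj g⁻¹ _)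
    rw [e1, mfderiv_id] at h1
    have hx : g⁻¹ * (g * x * g⁻¹) * g⁻¹⁻¹ = x := by simp [mul_assoc]
    rw [e2, mfderiv_id, hx] at h2
    have h3 : (mfderiv 𝓘(ℝ, EG) 𝓘(ℝ, EG) (fun y : G => g * y * g⁻¹) x).inverse =
        mfderiv 𝓘(ℝ, EG) 𝓘(ℝ, EG) (fun y : G => g⁻¹ * y * g⁻¹⁻¹) (g * x * g⁻¹) :=
      ContinuousLinearMap.inverse_eq h2.symm h1.symm
    rw [VectorField.mpullback_apply, h3, ← mfderiv_conj_mulInvariant]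
    exact (congrArg (fun L : EG →L[ℝ] EG => L (mulInvariantVectorField v x)) h1).symm
  have hb := VectorField.mpullback_mlieBracket (n := ∞) (I := 𝓘(ℝ, EG)) (I' := 𝓘(ℝ, EG))
    (f := fun x : G => g * x * g⁻¹) (x₀ := 1)
    (V := mulInvariantVectorField (I := 𝓘(ℝ, EG)) (G := G) (Ad EG g v))
    (W := mulInvariantVectorField (I := 𝓘(ℝ, EG)) (G := G) (Ad EG g w))
    (mdifferentiableAt_mulInvariantVectorField _) (mdifferentiableAt_mulInvariantVectorField _)
    (contMDiff_conj g 1)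
    (by rw [minSmoothness_of_isRCLikeNormedField]; exact ENat.LEInfty.out)
  have h1 : g * 1 * g⁻¹ = 1 := by simp
  have hinv : (Ad EG g).inverse = Ad EG g⁻¹ :=
    ContinuousLinearMap.inverse_eq (Ad_comp_inv g) (Ad_inv_comp g)
  rw [key, key, VectorField.mpullback_apply, h1] at hb
  have hb' : Ad EG g⁻¹ (⁅(show LieAlg EG G from Ad EG g v),
      (show LieAlg EG G from Ad EG g w)⁆ : LieAlg EG G) = (⁅v, w⁆ : LieAlg EG G) := by
    rw [← hinv]
    exact hb
  have h2 := congrArg (Ad EG g) hb'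
  have h3 := congrArg (fun L : EG →L[ℝ] EG => L (⁅(show LieAlg EG G from Ad EG g v),
      (show LieAlg EG G from Ad EG g w)⁆ : LieAlg EG G)) (Ad_comp_inv (EG := EG) g)
  exact h2.symm.trans h3

lemma killingForm_Ad [FiniteDimensional ℝ EG] (g : G) (v w : LieAlg EG G) :
    killingForm ℝ (LieAlg EG G) (Ad EG g v) (Ad EG g w) = killingForm ℝ (LieAlg EG G) v w := by
  let e : LieAlg EG G ≃ₗ⁅ℝ⁆ LieAlg EG G :=
    { toFun := fun v => Ad EG g v
      map_add' := fun v w => (Ad EG g).map_add v w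
      map_smul' := fun c v => (Ad EG g).map_smul c v
      map_lie' := fun {v w} => Ad_lie g v w
      invFun := fun v => Ad EG g⁻¹ v
      left_inv := fun v => congrArg (fun L : EG →L[ℝ] EG => L v) (Ad_inv_comp (EG := EG) g)
      right_inv := fun v => congrArg (fun L : EG →L[ℝ] EG => L v) (Ad_comp_inv (EG := EG) g) }
  exact LieAlgebra.killingForm_of_equiv_apply e v w

end LieGroups

section Contraction

lemma sum_dualBasis_eq {V W ι κ : Type*} [AddCommGroup V] [Module ℝ V] [AddCommGroup W] [Module ℝ W]
    [Fintype ι] [DecidableEq ι] [Fintype κ] [DecidableEq κ]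
    (B : LinearMap.BilinForm ℝ V) (hB : B.Nondegenerate) (b : Module.Basis ι ℝ V)
    (c : Module.Basis κ ℝ V) (T : V →ₗ[ℝ] V →ₗ[ℝ] W) :
    ∑ i, T (b i) (B.dualBasis hB b i) = ∑ j, T (c j) (B.dualBasis hB c j) := by
  have h1 : ∀ x : V, x = ∑ j, B (B.dualBasis hB c j) x • c j := by
    intro x
    conv_lhs => rw [← c.sum_repr x]
    refine Finset.sum_congr rfl fun j _ => ?_
    congr 1
    conv_rhs => rw [← c.sum_repr x]
    simp only [map_sum, map_smul, LinearMap.BilinForm.apply_dualBasis_left, smul_eq_mul]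
    simp
  have h2 : ∀ y : V, y = ∑ i, B y (b i) • B.dualBasis hB b i := by
    intro y
    conv_lhs => rw [← (B.dualBasis hB b).sum_repr y]
    simp [LinearMap.BilinForm.dualBasis_repr_apply]
  calc ∑ i, T (b i) (B.dualBasis hB b i)
      = ∑ i, ∑ j, B (B.dualBasis hB c j) (b i) • T (c j) (B.dualBasis hB b i) := by
        refine Finset.sum_congr rfl fun i _ => ?_
        conv_lhs => rw [h1 (b i)]
        simp
    _ = ∑ j, ∑ i, B (B.dualBasis hB c j) (b i) • T (c j) (B.dualBasis hB b i) :=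
        Finset.sum_comm
    _ = ∑ j, T (c j) (B.dualBasis hB c j) := by
        refine Finset.sum_congr rfl fun j _ => ?_
        conv_rhs => rw [h2 (B.dualBasis hB c j)]
        simp

variable {EG : Type*} [NormedAddCommGroup EG] [NormedSpace ℝ EG] [FiniteDimensional ℝ EG]
  {G : Type*} [TopologicalSpace G] [ChartedSpace EG G] [Group G] [LieGroup 𝓘(ℝ, EG) ∞ G]
  {W : Type*} [NormedAddCommGroup W] [NormedSpace ℝ W]

instance lieAlg_finiteDimensional : FiniteDimensional ℝ (LieAlg EG G) := inferInstanceAs (FiniteDimensional ℝ EG)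

variable (EG G) in
/-- A basis `{ξ^ℓ}` of the Lie algebra `𝔤`. -/
def lieBasis : Module.Basis (Fin (Module.finrank ℝ (LieAlg EG G))) ℝ (LieAlg EG G) :=
  Module.finBasis ℝ (LieAlg EG G)

variable [LieAlgebra.IsSemisimple ℝ (LieAlg EG G)]

variable (EG G) in
/-- The basis `{ξ_ℓ}` of the semisimple Lie algebra `𝔤` which is dual to `{ξ^ℓ}` with respect to
the Killing form. -/
def lieDualBasis : Module.Basis (Fin (Module.finrank ℝ (LieAlg EG G))) ℝ (LieAlg EG G) :=
  (killingForm ℝ (LieAlg EG G)).dualBasis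
    (LieAlgebra.IsKilling.killingForm_nondegenerate ℝ (LieAlg EG G)) (lieBasis EG G)

/-- A bilinear map on the model vector space, regarded as a bilinear map on the Lie algebra. -/
def toLieBilin (T : EG →L[ℝ] EG →L[ℝ] W) : LieAlg EG G →ₗ[ℝ] LieAlg EG G →ₗ[ℝ] W :=
  LinearMap.mk₂ ℝ (fun v w : LieAlg EG G => T v w)
    (fun v v' w => T.map_add₂ v v' w) (fun c v w => T.map_smul₂ c v w)
    (fun v w w' => (T v).map_add w w') (fun c v w => (T v).map_smul c w)

variable (G) in
/-- The contraction `B ⊗ id : 𝔤* ⊗ 𝔤* ⊗ W → W`, where `B` is the bilinear form on `𝔤*` which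
corresponds to the Killing form under the isomorphism `𝔤 ≅ 𝔤*`. Elements of `𝔤* ⊗ 𝔤* ⊗ W` are
regarded as bilinear maps `T : 𝔤 × 𝔤 → W`, and the contraction is `∑_ℓ T(ξ^ℓ, ξ_ℓ)`. By
`killingContract_eq` it does not depend on the basis. -/
def killingContract (T : EG →L[ℝ] EG →L[ℝ] W) : W :=
  ∑ ℓ, T (lieBasis EG G ℓ) (lieDualBasis EG G ℓ)

lemma killingContract_eq {κ : Type*} [Fintype κ] [DecidableEq κ]
    (c : Module.Basis κ ℝ (LieAlg EG G)) (T : EG →L[ℝ] EG →L[ℝ] W) :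
    killingContract G T = ∑ j, T (c j) ((killingForm ℝ (LieAlg EG G)).dualBasis
      (LieAlgebra.IsKilling.killingForm_nondegenerate ℝ (LieAlg EG G)) c j) :=
  sum_dualBasis_eq (killingForm ℝ (LieAlg EG G))
    (LieAlgebra.IsKilling.killingForm_nondegenerate ℝ (LieAlg EG G)) (lieBasis EG G) c
    (toLieBilin (G := G) T)

lemma killingContract_Ad (g : G) (T S : EG →L[ℝ] EG →L[ℝ] W)
    (hS : ∀ v w, S v w = T (Ad EG g v) (Ad EG g w)) :
    killingContract G S = killingContract G T := by
  classical
  let e : LieAlg EG G ≃ₗ[ℝ] LieAlg EG G :=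
    { toFun := fun v => Ad EG g v
      map_add' := fun v w => (Ad EG g).map_add v w
      map_smul' := fun c v => (Ad EG g).map_smul c v
      invFun := fun v => Ad EG g⁻¹ v
      left_inv := fun v => congrArg (fun L : EG →L[ℝ] EG => L v) (Ad_inv_comp (EG := EG) g)
      right_inv := fun v => congrArg (fun L : EG →L[ℝ] EG => L v) (Ad_comp_inv (EG := EG) g) }
  set B := killingForm ℝ (LieAlg EG G)
  have hB := LieAlgebra.IsKilling.killingForm_nondegenerate ℝ (LieAlg EG G)
  have hd : ∀ i, B.dualBasis hB ((lieBasis EG G).map e) i = e (lieDualBasis EG G i) := by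
    intro i
    apply (B.dualBasis hB ((lieBasis EG G).map e)).repr.injective
    ext j
    rw [LinearMap.BilinForm.dualBasis_repr_apply, LinearMap.BilinForm.dualBasis_repr_apply,
      LinearMap.BilinForm.apply_dualBasis_left, Module.Basis.map_apply]
    have := killingForm_Ad g (lieDualBasis EG G i) (lieBasis EG G j)
    refine Eq.trans ?_ this.symm
    exact (LinearMap.BilinForm.apply_dualBasis_left (B := B) hB (lieBasis EG G) i j).symm
  rw [killingContract_eq ((lieBasis EG G).map e) T]
  refine Finset.sum_congr rfl fun i _ => ?_
  refine (hS _ _).trans ?_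
  have h1 := hd i
  have h2 : (lieBasis EG G).map e i = e (lieBasis EG G i) := Module.Basis.map_apply _ _ _
  exact (congrArg₂ (fun v w : EG => T v w) h2 h1).symm

end Contraction

section Parabolic

open scoped TensorProduct

/-- A subalgebra `𝔭` of a real Lie algebra `𝔤` is parabolic if its complexification contains a
Borel subalgebra, i.e. a maximal solvable subalgebra, of the complexification of `𝔤`. -/
def IsParabolicSubalgebra {L : Type*} [LieRing L] [LieAlgebra ℝ L] (p : LieSubalgebra ℝ L) : Prop :=
  ∃ b : LieSubalgebra ℂ (ℂ ⊗[ℝ] L),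
    Maximal (fun c : LieSubalgebra ℂ (ℂ ⊗[ℝ] L) => LieAlgebra.IsSolvable c) b ∧
      b.toSubmodule ≤ p.toSubmodule.baseChange ℂ

variable (EG EP : Type*) [NormedAddCommGroup EG] [NormedSpace ℝ EG] [FiniteDimensional ℝ EG]
  [NormedAddCommGroup EP] [NormedSpace ℝ EP]
  {G : Type*} [TopologicalSpace G] [ChartedSpace EG G] [Group G] [LieGroup 𝓘(ℝ, EG) ∞ G]
  (P : Subgroup G) [ChartedSpace EP P]

/-- The inclusion `𝔭 = T₁P → T₁G = 𝔤` of Lie algebras, the derivative of `P ⊂ G` at `1`. -/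
def lieInclusion : LieAlg EP P →L[ℝ] LieAlg EG G :=
  mfderiv 𝓘(ℝ, EP) 𝓘(ℝ, EG) (Subtype.val : P → G) 1

/-- The subgroup `P` of the Lie group `G`, carrying its smooth structure as a Lie group, is a
parabolic subgroup: it is closed and embedded, and its Lie algebra is a parabolic subalgebra
of `𝔤`. -/
structure IsParabolicSubgroup : Prop where
  isClosed : IsClosed (P : Set G)
  isSmoothEmbedding :
    Manifold.IsSmoothEmbedding 𝓘(ℝ, EP) 𝓘(ℝ, EG) ∞ (Subtype.val : P → G)
  isParabolic : ∃ p : LieSubalgebra ℝ (LieAlg EG G),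
    p.toSubmodule = LinearMap.range (lieInclusion EG EP P : LieAlg EP P →ₗ[ℝ] LieAlg EG G) ∧
      IsParabolicSubalgebra p

end Parabolic

section Representations

variable (EP : Type*) [NormedAddCommGroup EP] [NormedSpace ℝ EP]
  {K : Type*} [TopologicalSpace K] [ChartedSpace EP K] [Group K]
  {W : Type*} [NormedAddCommGroup W] [NormedSpace ℝ W]

/-- The representation `ρ` of the Lie group `K` on `W` is smooth. -/
class IsSmoothRep (ρ : Representation ℝ K W) : Prop where
  contMDiff_apply (w : W) : ContMDiff 𝓘(ℝ, EP) 𝓘(ℝ, W) ∞ (fun h : K => ρ h w)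

variable [FiniteDimensional ℝ W]

instance submodule_isClosed (W₀ : Submodule ℝ W) : IsClosed (W₀ : Set W) :=
  W₀.closed_of_finiteDimensional

instance (ρ : Representation ℝ K W) [IsSmoothRep EP ρ] (W₀ : Submodule ℝ W)
    (hW₀ : ∀ h, W₀ ≤ W₀.comap (ρ h)) : IsSmoothRep EP (ρ.subrepresentation W₀ hW₀) where
  contMDiff_apply w := by
    obtain ⟨r, hr⟩ := W₀.subtype.exists_leftInverse_of_injective (Submodule.ker_subtype W₀)
    have h1 := (LinearMap.toContinuousLinearMap r).contMDiff (n := ∞).comp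
      (IsSmoothRep.contMDiff_apply (EP := EP) (ρ := ρ) (w : W))
    refine h1.congr fun h => ?_
    exact (congrArg (fun L : W₀ →ₗ[ℝ] W₀ => L (ρ.subrepresentation W₀ hW₀ h w)) hr).symm

instance (ρ : Representation ℝ K W) [IsSmoothRep EP ρ] (W₀ : Submodule ℝ W)
    (hW₀ : ∀ h, W₀ ≤ W₀.comap (ρ h)) : IsSmoothRep EP (ρ.quotient W₀ hW₀) where
  contMDiff_apply w := by
    obtain ⟨w, rfl⟩ := W₀.mkQ_surjective w
    exact (LinearMap.toContinuousLinearMap W₀.mkQ).contMDiff (n := ∞).comp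
      (IsSmoothRep.contMDiff_apply (EP := EP) (ρ := ρ) w)

/-- The inclusion `W₀ → W` of a subrepresentation. -/
def subInclusion (ρ : Representation ℝ K W) (W₀ : Submodule ℝ W)
    (hW₀ : ∀ h, W₀ ≤ W₀.comap (ρ h)) : (ρ.subrepresentation W₀ hW₀).IntertwiningMap ρ where
  toLinearMap := W₀.subtype
  isIntertwining' _ := rfl

/-- The projection `W → W/W₀` to the quotient by a subrepresentation. -/
def quotientProj (ρ : Representation ℝ K W) (W₀ : Submodule ℝ W)
    (hW₀ : ∀ h, W₀ ≤ W₀.comap (ρ h)) : ρ.IntertwiningMap (ρ.quotient W₀ hW₀) where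
  toLinearMap := W₀.mkQ
  isIntertwining' _ := rfl

variable {EG : Type*} [NormedAddCommGroup EG] [NormedSpace ℝ EG]
  {G : Type*} [TopologicalSpace G] [ChartedSpace EG G] [Group G] [LieGroup 𝓘(ℝ, EG) ∞ G]
  {P : Subgroup G}

variable (EG) in
/-- The representation of `P` on `𝔤* ⊗ W = L(𝔤, W)` induced by the adjoint action on `𝔤` and the
representation `ρ` on `W`, i.e. `(h · T)(X) = h · T(Ad(h⁻¹) X)`. -/
def homRep (ρ : Representation ℝ P W) : Representation ℝ P (EG →L[ℝ] W) where
  toFun h :=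
    { toFun := fun T => (LinearMap.toContinuousLinearMap (ρ h)).comp (T.comp (Ad EG (h⁻¹ : G)))
      map_add' := fun T S => by ext X; simp
      map_smul' := fun c T => by ext X; simp }
  map_one' := by
    ext T X
    simp [Ad_one]
  map_mul' h k := by
    ext T X
    simp [Ad_mul]

lemma homRep_apply (ρ : Representation ℝ P W) (h : P) (T : EG →L[ℝ] W) (X : EG) :
    homRep EG ρ h T X = ρ h (T (Ad EG (h⁻¹ : G) X)) := rfl

end Representations

section Smoothness

variable {E V W : Type*} [NormedAddCommGroup E] [NormedSpace ℝ E]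
  [NormedAddCommGroup V] [NormedSpace ℝ V] [FiniteDimensional ℝ V]
  [NormedAddCommGroup W] [NormedSpace ℝ W]
  {X : Type*} [TopologicalSpace X] [ChartedSpace E X]

lemma contMDiffAt_clm_of_apply {f : X → V →L[ℝ] W} {x : X}
    (hf : ∀ v, ContMDiffAt 𝓘(ℝ, E) 𝓘(ℝ, W) ∞ (fun y => f y v) x) :
    ContMDiffAt 𝓘(ℝ, E) 𝓘(ℝ, V →L[ℝ] W) ∞ f x := by
  let b := Module.finBasis ℝ V
  have h1 : f = fun y => ∑ i, ContinuousLinearMap.smulRightL ℝ V W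
      (LinearMap.toContinuousLinearMap (b.coord i)) (f y (b i)) := by
    funext y
    ext v
    have h2 : f y v = f y (∑ i, b.repr v i • b i) := by rw [b.sum_repr v]
    rw [h2, map_sum]
    simp
  rw [h1]
  refine ContMDiffAt.sum fun i _ => ?_
  exact (ContinuousLinearMap.contMDiff (n := ∞) (ContinuousLinearMap.smulRightL ℝ V W
      (LinearMap.toContinuousLinearMap (b.coord i)))).contMDiffAt.comp x (hf (b i))

end Smoothness

section CartanGeometries

set_option linter.unusedSectionVars false

/-- A Cartan geometry `(p : 𝒢 → M, ω)` of type `(G, P)`: a smooth principal `P`-bundle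
`p : 𝒢 → M` with a Cartan connection `ω ∈ Ω¹(𝒢, 𝔤)`. If `G` is semisimple and `P ⊂ G` is parabolic,
this is a parabolic geometry of type `(G, P)`. Here `EG`, `EP`, `EM`, `EQ` are the model vector
spaces of the manifolds `G`, `P`, `M`, `𝒢`. -/
structure CartanGeometry (EG EP EM EQ : Type*) [NormedAddCommGroup EG] [NormedSpace ℝ EG]
    [NormedAddCommGroup EP] [NormedSpace ℝ EP] [NormedAddCommGroup EM] [NormedSpace ℝ EM]
    [NormedAddCommGroup EQ] [NormedSpace ℝ EQ]
    {G : Type*} [TopologicalSpace G] [ChartedSpace EG G] [Group G]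
    (P : Subgroup G) [ChartedSpace EP P]
    (M : Type*) [TopologicalSpace M] [ChartedSpace EM M]
    (Q : Type*) [TopologicalSpace Q] [ChartedSpace EQ Q] [IsManifold 𝓘(ℝ, EQ) ∞ Q] where
  /-- the bundle projection `p : 𝒢 → M` -/
  proj : Q → M
  contMDiff_proj : ContMDiff 𝓘(ℝ, EQ) 𝓘(ℝ, EM) ∞ proj
  /-- the principal right action `(u, h) ↦ u · h` of `P` on `𝒢` -/
  act : Q → P → Q
  contMDiff_act : ContMDiff (𝓘(ℝ, EQ).prod 𝓘(ℝ, EP)) 𝓘(ℝ, EQ) ∞ (fun x : Q × P => act x.1 x.2)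
  act_one (u : Q) : act u 1 = u
  act_mul (u : Q) (h k : P) : act u (h * k) = act (act u h) k
  proj_act (u : Q) (h : P) : proj (act u h) = proj u
  /-- `𝒢` is locally trivial: over suitable neighbourhoods `U` of each point there is a
  `P`-equivariant diffeomorphism `p⁻¹(U) ≅ U × P` over `U`. -/
  exists_trivialization (x : M) : ∃ e : Trivialization P proj, x ∈ e.baseSet ∧
    ContMDiffOn 𝓘(ℝ, EQ) (𝓘(ℝ, EM).prod 𝓘(ℝ, EP)) ∞ e e.source ∧
    ContMDiffOn (𝓘(ℝ, EM).prod 𝓘(ℝ, EP)) 𝓘(ℝ, EQ) ∞ e.toOpenPartialHomeomorph.symm e.target ∧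
    ∀ u ∈ e.source, ∀ h : P, (e (act u h)).2 = (e u).2 * h
  /-- the Cartan connection `ω` -/
  conn (u : Q) : TangentSpace 𝓘(ℝ, EQ) u →L[ℝ] EG
  contMDiff_conn : ContMDiff 𝓘(ℝ, EQ).tangent 𝓘(ℝ, EG) ∞
    (fun ξ : TangentBundle 𝓘(ℝ, EQ) Q => conn ξ.proj ξ.snd)
  /-- `ω` defines an isomorphism `T𝒢 ≅ 𝒢 × 𝔤` -/
  bijective_conn (u : Q) : Function.Bijective (conn u)
  /-- `ω` is equivariant: `(r^h)^* ω = Ad(h⁻¹) ∘ ω` for the principal right action `r^h` -/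
  conn_act (u : Q) (h : P) (ξ : TangentSpace 𝓘(ℝ, EQ) u) :
    conn (act u h) (mfderiv 𝓘(ℝ, EQ) 𝓘(ℝ, EQ) (fun v => act v h) u ξ) = Ad EG (h⁻¹ : G) (conn u ξ)
  /-- `ω` reproduces the generators of fundamental vector fields -/
  conn_fundamental (u : Q) (X : LieAlg EP P) :
    conn (act u 1) (mfderiv 𝓘(ℝ, EP) 𝓘(ℝ, EQ) (act u) 1 X) = lieInclusion EG EP P X

namespace CartanGeometry

variable {EG EP EM EQ : Type*} [NormedAddCommGroup EG] [NormedSpace ℝ EG] [FiniteDimensional ℝ EG]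
  [NormedAddCommGroup EP] [NormedSpace ℝ EP] [FiniteDimensional ℝ EP]
  [NormedAddCommGroup EM] [NormedSpace ℝ EM]
  [NormedAddCommGroup EQ] [NormedSpace ℝ EQ] [FiniteDimensional ℝ EQ]
  {G : Type*} [TopologicalSpace G] [ChartedSpace EG G] [Group G] [LieGroup 𝓘(ℝ, EG) ∞ G]
  {P : Subgroup G} [ChartedSpace EP P] [LieGroup 𝓘(ℝ, EP) ∞ P]
  {M : Type*} [TopologicalSpace M] [ChartedSpace EM M] [IsManifold 𝓘(ℝ, EM) ∞ M]
  {Q : Type*} [TopologicalSpace Q] [ChartedSpace EQ Q] [IsManifold 𝓘(ℝ, EQ) ∞ Q]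
  (𝓖 : CartanGeometry EG EP EM EQ P M Q)
  {W : Type*} [NormedAddCommGroup W] [NormedSpace ℝ W] [FiniteDimensional ℝ W]
  (ρ : Representation ℝ P W)
  {W' : Type*} [NormedAddCommGroup W'] [NormedSpace ℝ W'] [FiniteDimensional ℝ W']
  (ρ' : Representation ℝ P W')

/-! ### The principal action -/

lemma act_act_inv (u : Q) (h : P) : 𝓖.act (𝓖.act u h) h⁻¹ = u := by
  rw [← 𝓖.act_mul, mul_inv_cancel, 𝓖.act_one]

lemma act_inv_act (u : Q) (h : P) : 𝓖.act (𝓖.act u h⁻¹) h = u := by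
  rw [← 𝓖.act_mul, inv_mul_cancel, 𝓖.act_one]

lemma proj_surjective : Function.Surjective 𝓖.proj := by
  intro x
  obtain ⟨e, hx, -⟩ := 𝓖.exists_trivialization x
  obtain ⟨u, -, hu⟩ := e.proj_surjOn_baseSet hx
  exact ⟨u, hu⟩

lemma act_injective (u : Q) : Function.Injective (𝓖.act u) := by
  intro h k hk
  obtain ⟨e, hx, -, -, he⟩ := 𝓖.exists_trivialization (𝓖.proj u)
  have hu : u ∈ e.source := e.mem_source.2 hx
  have h1 := he u hu h
  rw [hk, he u hu k] at h1
  exact (mul_left_cancel h1).symm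

lemma exists_act_eq {u v : Q} (huv : 𝓖.proj u = 𝓖.proj v) : ∃ h, 𝓖.act u h = v := by
  obtain ⟨e, hx, -, -, he⟩ := 𝓖.exists_trivialization (𝓖.proj u)
  have hu : u ∈ e.source := e.mem_source.2 hx
  have hv : v ∈ e.source := e.mem_source.2 (huv ▸ hx)
  refine ⟨(e u).2⁻¹ * (e v).2, ?_⟩
  have hs : 𝓖.act u ((e u).2⁻¹ * (e v).2) ∈ e.source :=
    e.mem_source.2 (by rw [𝓖.proj_act]; exact hx)
  apply e.injOn hs hv
  apply Prod.ext
  · change (e _).1 = (e _).1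
    rw [e.coe_fst hs, e.coe_fst hv, 𝓖.proj_act, huv]
  · change (e _).2 = (e _).2
    rw [he u hu, mul_inv_cancel_left]

lemma contMDiff_act_right (h : P) : ContMDiff 𝓘(ℝ, EQ) 𝓘(ℝ, EQ) ∞ (fun v => 𝓖.act v h) :=
  𝓖.contMDiff_act.comp (contMDiff_id.prodMk contMDiff_const)

/-! ### Natural bundles and their sections -/

/-- The equivalence relation on `𝒢 × W` given by the right action `(u, w) · h = (u · h, h⁻¹ · w)`. -/
def assocSetoid : Setoid (Q × W) where
  r a b := ∃ h : P, b = (𝓖.act a.1 h, ρ h⁻¹ a.2)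
  iseqv :=
    { refl := fun a => ⟨1, by simp [𝓖.act_one]⟩
      symm := by
        rintro a b ⟨h, rfl⟩
        exact ⟨h⁻¹, by simp [𝓖.act_act_inv]⟩
      trans := by
        rintro a b c ⟨h, rfl⟩ ⟨k, rfl⟩
        exact ⟨h * k, by simp [𝓖.act_mul]⟩ }

/-- The natural bundle `WM = 𝒢 ×_P W = (𝒢 × W)/P` induced by the representation `W` of `P`. -/
def Assoc : Type _ := Quotient (𝓖.assocSetoid ρ)

variable {ρ} in
/-- The class `[u, w] ∈ 𝒢 ×_P W`. -/
def cls (u : Q) (w : W) : 𝓖.Assoc ρ := Quotient.mk (𝓖.assocSetoid ρ) (u, w)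

variable {𝓖 ρ} in
/-- The bundle projection `WM → M`, `[u, w] ↦ p(u)`. -/
def Assoc.proj : 𝓖.Assoc ρ → M :=
  Quotient.lift (fun a : Q × W => 𝓖.proj a.1) (by
    rintro a b ⟨h, rfl⟩
    exact (𝓖.proj_act _ _).symm)

lemma cls_eq_cls_iff {u v : Q} {w z : W} :
    (𝓖.cls u w : 𝓖.Assoc ρ) = 𝓖.cls v z ↔ ∃ h : P, v = 𝓖.act u h ∧ z = ρ h⁻¹ w := by
  refine ⟨fun h => ?_, fun ⟨h, h1, h2⟩ => Quotient.sound ⟨h, Prod.ext h1 h2⟩⟩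
  obtain ⟨h, hh⟩ := Quotient.exact h
  exact ⟨h, congrArg Prod.fst hh, congrArg Prod.snd hh⟩

lemma cls_act (u : Q) (h : P) (w : W) :
    (𝓖.cls (𝓖.act u h) w : 𝓖.Assoc ρ) = 𝓖.cls u (ρ h w) :=
  ((𝓖.cls_eq_cls_iff ρ).2 ⟨h, rfl, by simp⟩).symm

lemma cls_injective (u : Q) : Function.Injective (𝓖.cls u : W → 𝓖.Assoc ρ) := by
  intro w z h
  obtain ⟨h, h1, h2⟩ := (𝓖.cls_eq_cls_iff ρ).1 h
  have : h = 1 := 𝓖.act_injective u (by rw [← h1, 𝓖.act_one])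
  simp [h2, this]

lemma exists_eq_cls (u : Q) (a : 𝓖.Assoc ρ) (ha : a.proj = 𝓖.proj u) : ∃ w, a = 𝓖.cls u w := by
  obtain ⟨⟨v, z⟩, rfl⟩ := Quotient.exists_rep a
  obtain ⟨h, hh⟩ := 𝓖.exists_act_eq (u := u) (v := v) ha.symm
  exact ⟨ρ h z, by rw [← 𝓖.cls_act, hh]; rfl⟩

/-- The space `Γ(WM)` of smooth sections of the natural bundle `WM = 𝒢 ×_P W`. Any smooth section
`s` of `𝒢` over an open subset `V ⊂ M` induces the smooth local trivialization
`V × W ≅ WM|_V`, `(x, w) ↦ [s(x), w]`; a section of `WM` is smooth if it is given by smooth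
`W`-valued functions in all these trivializations. -/
structure Sect where
  /-- the underlying map `M → WM` -/
  toFun : M → 𝓖.Assoc ρ
  proj_toFun (x : M) : (toFun x).proj = x
  smooth (V : Set M) (s : M → Q) (hV : IsOpen V) (hs : ContMDiffOn 𝓘(ℝ, EM) 𝓘(ℝ, EQ) ∞ s V)
    (hps : ∀ x ∈ V, 𝓖.proj (s x) = x) :
    ∃ v : M → W, ContMDiffOn 𝓘(ℝ, EM) 𝓘(ℝ, W) ∞ v V ∧ ∀ x ∈ V, toFun x = 𝓖.cls (s x) (v x)

instance : CoeFun (𝓖.Sect ρ) (fun _ => M → 𝓖.Assoc ρ) := ⟨Sect.toFun⟩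

variable {𝓖 ρ} in
@[ext] lemma Sect.ext {σ τ : 𝓖.Sect ρ} (h : ∀ x, σ x = τ x) : σ = τ := by
  cases σ; cases τ
  congr
  exact funext h

/-- The space `C^∞(𝒢, W)^P` of smooth functions `f : 𝒢 → W` which are `P`-equivariant,
i.e. satisfy `f(u · h) = h⁻¹ · f(u)`. -/
structure EquivFun where
  /-- the underlying map `𝒢 → W` -/
  toFun : Q → W
  smooth : ContMDiff 𝓘(ℝ, EQ) 𝓘(ℝ, W) ∞ toFun
  equivariant (u : Q) (h : P) : toFun (𝓖.act u h) = ρ h⁻¹ (toFun u)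

instance : CoeFun (𝓖.EquivFun ρ) (fun _ => Q → W) := ⟨EquivFun.toFun⟩

variable {𝓖 ρ} in
@[ext] lemma EquivFun.ext {f g : 𝓖.EquivFun ρ} (h : ∀ u, f u = g u) : f = g := by
  cases f; cases g
  congr
  exact funext h

variable {𝓖 ρ}

/-- The section `p(u) ↦ [u, f(u)]` of `WM` defined by the equivariant function `f`. -/
def EquivFun.toSect (f : 𝓖.EquivFun ρ) : 𝓖.Sect ρ where
  toFun x := 𝓖.cls (Function.surjInv 𝓖.proj_surjective x) (f (Function.surjInv 𝓖.proj_surjective x))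
  proj_toFun x := Function.surjInv_eq 𝓖.proj_surjective x
  smooth V s hV hs hps := by
    refine ⟨fun x => f (s x), f.smooth.comp_contMDiffOn hs, fun x hx => ?_⟩
    obtain ⟨h, hh⟩ := 𝓖.exists_act_eq
      (((Function.surjInv_eq 𝓖.proj_surjective x).trans (hps x hx).symm))
    exact (𝓖.cls_eq_cls_iff ρ).2 ⟨h, hh.symm, by rw [← f.equivariant, hh]⟩

lemma EquivFun.toSect_proj (f : 𝓖.EquivFun ρ) (u : Q) : f.toSect (𝓖.proj u) = 𝓖.cls u (f u) := by
  obtain ⟨h, hh⟩ := 𝓖.exists_act_eq (Function.surjInv_eq 𝓖.proj_surjective (𝓖.proj u))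
  exact (𝓖.cls_eq_cls_iff ρ).2 ⟨h, hh.symm, by rw [← f.equivariant, hh]⟩

/-- The function `f : 𝒢 → W` with `σ(p(u)) = [u, f(u)]`. -/
def Sect.frameFun (σ : 𝓖.Sect ρ) (u : Q) : W :=
  (𝓖.exists_eq_cls ρ u (σ (𝓖.proj u)) (σ.proj_toFun _)).choose

lemma Sect.eq_cls_frameFun (σ : 𝓖.Sect ρ) (u : Q) : σ (𝓖.proj u) = 𝓖.cls u (σ.frameFun u) :=
  (𝓖.exists_eq_cls ρ u (σ (𝓖.proj u)) (σ.proj_toFun _)).choose_spec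

lemma Sect.frameFun_act (σ : 𝓖.Sect ρ) (u : Q) (h : P) :
    σ.frameFun (𝓖.act u h) = ρ h⁻¹ (σ.frameFun u) := by
  apply 𝓖.cls_injective ρ (𝓖.act u h)
  rw [← Sect.eq_cls_frameFun, 𝓖.proj_act, 𝓖.cls_act, Sect.eq_cls_frameFun]
  simp

lemma Sect.contMDiff_frameFun [IsSmoothRep EP ρ] (σ : 𝓖.Sect ρ) :
    ContMDiff 𝓘(ℝ, EQ) 𝓘(ℝ, W) ∞ σ.frameFun := by
  intro u₀
  obtain ⟨e, hx, he1, he2, he⟩ := 𝓖.exists_trivialization (𝓖.proj u₀)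
  have hu₀ : u₀ ∈ e.source := e.mem_source.2 hx
  let s : M → Q := fun x => e.toOpenPartialHomeomorph.symm (x, 1)
  have hs : ContMDiffOn 𝓘(ℝ, EM) 𝓘(ℝ, EQ) ∞ s e.baseSet :=
    he2.comp (contMDiffOn_id.prodMk contMDiffOn_const) fun x hx => e.mem_target.2 hx
  obtain ⟨v, hv, hσ⟩ := σ.smooth e.baseSet s e.open_baseSet hs fun x hx => e.proj_symm_apply' hx
  have key : ∀ u ∈ e.source, σ.frameFun u = ρ (e u).2⁻¹ (v (𝓖.proj u)) := by
    intro u hu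
    have hb : 𝓖.proj u ∈ e.baseSet := e.mem_source.1 hu
    have hsu : s (𝓖.proj u) ∈ e.source := e.map_target (e.mem_target.2 hb)
    have hes : e (s (𝓖.proj u)) = (𝓖.proj u, 1) := e.apply_symm_apply' hb
    have hact : 𝓖.act (s (𝓖.proj u)) (e u).2 = u := by
      have h1 : 𝓖.act (s (𝓖.proj u)) (e u).2 ∈ e.source :=
        e.mem_source.2 (by rw [𝓖.proj_act]; exact e.mem_source.1 hsu)
      apply e.injOn h1 hu
      apply Prod.ext
      · change (e _).1 = (e _).1
        rw [e.coe_fst h1, e.coe_fst hu, 𝓖.proj_act]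
        exact e.proj_symm_apply' hb
      · change (e _).2 = (e _).2
        rw [he _ hsu, hes, one_mul]
    apply 𝓖.cls_injective ρ u
    rw [← Sect.eq_cls_frameFun, hσ _ hb]
    conv_rhs => rw [← hact, 𝓖.cls_act, hact]
    simp
  have h2 : ContMDiffAt 𝓘(ℝ, EQ) 𝓘(ℝ, EP) ∞ (fun u => ((e u).2⁻¹ : P)) u₀ :=
    (contMDiff_inv 𝓘(ℝ, EP) ∞).contMDiffAt.comp u₀
      (contMDiffAt_snd.comp u₀ (he1.contMDiffAt (e.open_source.mem_nhds hu₀)))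
  have h3 : ContMDiffAt 𝓘(ℝ, EQ) 𝓘(ℝ, W →L[ℝ] W) ∞
      (fun u => LinearMap.toContinuousLinearMap (ρ (e u).2⁻¹)) u₀ :=
    contMDiffAt_clm_of_apply fun w =>
      (IsSmoothRep.contMDiff_apply (EP := EP) (ρ := ρ) w).contMDiffAt.comp u₀ h2
  have h4 : ContMDiffAt 𝓘(ℝ, EQ) 𝓘(ℝ, W) ∞ (fun u => v (𝓖.proj u)) u₀ :=
    (hv.contMDiffAt (e.open_baseSet.mem_nhds hx)).comp u₀ 𝓖.contMDiff_proj.contMDiffAt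
  refine (h3.clm_apply h4).congr_of_eventuallyEq ?_
  filter_upwards [e.open_source.mem_nhds hu₀] with u hu
  exact key u hu

/-- The equivariant function `f` corresponding to the section `σ`, characterized by
`σ(p(u)) = [u, f(u)]`. -/
def Sect.toEquivFun [IsSmoothRep EP ρ] (σ : 𝓖.Sect ρ) : 𝓖.EquivFun ρ where
  toFun := σ.frameFun
  smooth := σ.contMDiff_frameFun
  equivariant := σ.frameFun_act

variable (𝓖 ρ) in
/-- The identification `Γ(WM) ≅ C^∞(𝒢, W)^P`. -/
def sectEquiv [IsSmoothRep EP ρ] : 𝓖.Sect ρ ≃ 𝓖.EquivFun ρ where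
  toFun := Sect.toEquivFun
  invFun := EquivFun.toSect
  left_inv σ := by
    ext x
    obtain ⟨u, rfl⟩ := 𝓖.proj_surjective x
    rw [EquivFun.toSect_proj, Sect.eq_cls_frameFun]
    rfl
  right_inv f := by
    ext u
    apply 𝓖.cls_injective ρ u
    exact (Sect.eq_cls_frameFun f.toSect u).symm.trans (f.toSect_proj u)

/-- The natural bundle map `WM → W'M`, `[u, w] ↦ [u, Φ(w)]`, induced by the equivariant linear
map `Φ : W → W'`. -/
def bundleMap (Φ : ρ.IntertwiningMap ρ') : 𝓖.Assoc ρ → 𝓖.Assoc ρ' :=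
  Quotient.lift (fun a : Q × W => (𝓖.cls a.1 (Φ a.2) : 𝓖.Assoc ρ')) (by
    rintro a b ⟨h, rfl⟩
    refine (𝓖.cls_eq_cls_iff ρ').2 ⟨h, rfl, ?_⟩
    exact Representation.IntertwiningMap.isIntertwining _ _ Φ h⁻¹ a.2)

/-- The map `Γ(WM) → Γ(W'M)` on sections induced by the natural bundle map `Φ`. -/
def sectMap (Φ : ρ.IntertwiningMap ρ') (σ : 𝓖.Sect ρ) : 𝓖.Sect ρ' where
  toFun x := bundleMap ρ' Φ (σ x)
  proj_toFun x := by
    obtain ⟨u, rfl⟩ := 𝓖.proj_surjective x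
    rw [σ.eq_cls_frameFun]
    rfl
  smooth V s hV hs hps := by
    obtain ⟨v, hv, hσ⟩ := σ.smooth V s hV hs hps
    refine ⟨fun x => Φ (v x), ?_, fun x hx => ?_⟩
    · exact (LinearMap.toContinuousLinearMap Φ.toLinearMap).contMDiff.comp_contMDiffOn hv
    · rw [hσ x hx]
      rfl

/-! ### The fundamental derivative and the curved Casimir operator -/

instance tangentSpace_finiteDimensional (u : Q) :
    FiniteDimensional ℝ (TangentSpace 𝓘(ℝ, EQ) u) :=
  inferInstanceAs (FiniteDimensional ℝ EQ)

instance tangentSpace_t2Space (u : Q) : T2Space (TangentSpace 𝓘(ℝ, EQ) u) :=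
  inferInstanceAs (T2Space EQ)

variable (𝓖) in
/-- The isomorphism `ω(u) : T_u 𝒢 ≅ 𝔤`. -/
def connEquiv (u : Q) : TangentSpace 𝓘(ℝ, EQ) u ≃L[ℝ] EG :=
  (LinearEquiv.ofBijective (𝓖.conn u : TangentSpace 𝓘(ℝ, EQ) u →ₗ[ℝ] EG)
    (𝓖.bijective_conn u)).toContinuousLinearEquiv

lemma connEquiv_apply (u : Q) (ξ : TangentSpace 𝓘(ℝ, EQ) u) : 𝓖.connEquiv u ξ = 𝓖.conn u ξ := rfl

variable (𝓖) in
/-- The vector fields `ω⁻¹(X)`, `X ∈ 𝔤`, on `𝒢` are smooth. -/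
lemma contMDiff_connEquiv_symm (X : EG) :
    ContMDiff 𝓘(ℝ, EQ) 𝓘(ℝ, EQ).tangent ∞
      (fun u : Q => (⟨u, (𝓖.connEquiv u).symm X⟩ : TangentBundle 𝓘(ℝ, EQ) Q)) := by
  intro u₀
  let e := trivializationAt EQ (TangentSpace 𝓘(ℝ, EQ) : Q → Type _) u₀
  have hu₀ : u₀ ∈ e.baseSet := mem_baseSet_trivializationAt _ _ _
  have hb : e.baseSet ∈ nhds u₀ := e.open_baseSet.mem_nhds hu₀
  let A : Q → EQ →L[ℝ] EG := fun u => (𝓖.conn u).comp (e.symmL ℝ u)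
  have hA : ContMDiffAt 𝓘(ℝ, EQ) 𝓘(ℝ, EQ →L[ℝ] EG) ∞ A u₀ := by
    refine contMDiffAt_clm_of_apply fun v => ?_
    have h1 : ContMDiffAt 𝓘(ℝ, EQ) 𝓘(ℝ, EQ).tangent ∞
        (fun u : Q => (⟨u, e.symmL ℝ u v⟩ : TangentBundle 𝓘(ℝ, EQ) Q)) u₀ := by
      rw [contMDiffAt_section]
      refine (contMDiffAt_const (c := v)).congr_of_eventuallyEq ?_
      filter_upwards [hb] with u hu
      rw [e.symmL_apply hu]
      exact congrArg Prod.snd (e.apply_mk_symm hu v)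
    exact 𝓖.contMDiff_conn.contMDiffAt.comp u₀ h1
  have hAe : ∀ (u : Q) (hu : u ∈ e.baseSet), A u =
      (((e.continuousLinearEquivAt ℝ u hu).symm.trans (𝓖.connEquiv u) : EQ ≃L[ℝ] EG) :
        EQ →L[ℝ] EG) := by
    intro u hu
    have h := e.symm_continuousLinearEquivAt_eq' (R := ℝ) hu
    change (𝓖.conn u).comp (e.symmL ℝ u) = _
    rw [← h]
    rfl
  rw [contMDiffAt_section]
  have h2 : ContMDiffAt 𝓘(ℝ, EQ) 𝓘(ℝ, EQ) ∞ (fun u => (A u).inverse X) u₀ := by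
    have h3 : ContDiffAt ℝ ∞ ContinuousLinearMap.inverse (A u₀) := by
      rw [hAe u₀ hu₀]
      exact contDiffAt_map_inverse _
    exact ((h3.contMDiffAt).comp u₀ hA).clm_apply contMDiffAt_const
  refine h2.congr_of_eventuallyEq ?_
  filter_upwards [hb] with u hu
  rw [hAe u hu, ContinuousLinearMap.inverse_equiv]
  rfl

variable (𝓖) in
/-- The derivative of an equivariant function `f`, in terms of the Cartan connection:
`(Df)(u)(X)` is the derivative of `f` at `u` in the direction `ω(u)⁻¹(X)`. -/
def fundDFun (f : Q → W) (u : Q) : EG →L[ℝ] W :=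
  ContinuousLinearMap.comp (mfderiv 𝓘(ℝ, EQ) 𝓘(ℝ, W) f u : TangentSpace 𝓘(ℝ, EQ) u →L[ℝ] W)
    ((𝓖.connEquiv u).symm : EG →L[ℝ] TangentSpace 𝓘(ℝ, EQ) u)


lemma contMDiff_fundDFun_apply {f : Q → W} (hf : ContMDiff 𝓘(ℝ, EQ) 𝓘(ℝ, W) ∞ f) (X : EG) :
    ContMDiff 𝓘(ℝ, EQ) 𝓘(ℝ, W) ∞ (fun u => 𝓖.fundDFun f u X) :=
  (contMDiff_snd_tangentBundle_modelSpace W 𝓘(ℝ, W)).comp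
    ((hf.contMDiff_tangentMap (m := ∞) (by simp)).comp (𝓖.contMDiff_connEquiv_symm X))

lemma connEquiv_symm_act (u : Q) (h : P) (X : EG) :
    (𝓖.connEquiv (𝓖.act u h)).symm X =
      mfderiv 𝓘(ℝ, EQ) 𝓘(ℝ, EQ) (fun v => 𝓖.act v h) u
        ((𝓖.connEquiv u).symm (Ad EG (h : G) X)) := by
  apply (𝓖.connEquiv (𝓖.act u h)).injective
  rw [ContinuousLinearEquiv.apply_symm_apply, connEquiv_apply]
  refine Eq.symm ((𝓖.conn_act u h _).trans ?_)
  rw [← connEquiv_apply, ContinuousLinearEquiv.apply_symm_apply]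
  exact congrArg (fun L : EG →L[ℝ] EG => L X) (Ad_inv_comp (EG := EG) (h : G))

lemma fundDFun_act (f : 𝓖.EquivFun ρ) (u : Q) (h : P) :
    𝓖.fundDFun f (𝓖.act u h) = homRep EG ρ h⁻¹ (𝓖.fundDFun f u) := by
  ext X
  have hm : MDifferentiableAt 𝓘(ℝ, EQ) 𝓘(ℝ, W) f.toFun (𝓖.act u h) :=
    f.smooth.mdifferentiable (by simp) _
  have ha : MDifferentiableAt 𝓘(ℝ, EQ) 𝓘(ℝ, EQ) (fun v => 𝓖.act v h) u :=
    (𝓖.contMDiff_act_right h).mdifferentiable (by simp) _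
  have h1 := mfderiv_comp (I := 𝓘(ℝ, EQ)) (I' := 𝓘(ℝ, EQ)) (I'' := 𝓘(ℝ, W)) u hm ha
  have h2 : f.toFun ∘ (fun v => 𝓖.act v h) =
      LinearMap.toContinuousLinearMap (ρ h⁻¹) ∘ f.toFun := funext fun v => f.equivariant v h
  have h3 := mfderiv_comp (I := 𝓘(ℝ, EQ)) (I' := 𝓘(ℝ, W)) (I'' := 𝓘(ℝ, W)) u
    (LinearMap.toContinuousLinearMap (ρ h⁻¹)).mdifferentiableAt
    (f.smooth.mdifferentiable (by simp) u)
  rw [ContinuousLinearMap.mfderiv_eq] at h3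
  rw [h2, h3] at h1
  rw [homRep_apply]
  have h4 := congrArg (fun L : EQ →L[ℝ] W => L ((𝓖.connEquiv u).symm (Ad EG (h : G) X))) h1
  refine Eq.trans ?_ (h4.symm.trans ?_)
  · exact congrArg (fun ξ : EQ => (mfderiv 𝓘(ℝ, EQ) 𝓘(ℝ, W) f.toFun (𝓖.act u h) : EQ →L[ℝ] W) ξ)
      (connEquiv_symm_act u h X)
  · simp only [inv_inv, InvMemClass.coe_inv]
    rfl

/-- The fundamental derivative `D : Γ(WM) → Γ(𝒜^*M ⊗ WM)`, where `𝒜M = 𝒢 ×_P 𝔤` is the adjoint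
tractor bundle, in the picture of equivariant functions: `(Df)(u)(X) = (ω⁻¹(X) · f)(u)`. Here
`𝒜^*M ⊗ WM` is the natural bundle induced by the representation `𝔤^* ⊗ W = L(𝔤, W)`. -/
def EquivFun.fundD (f : 𝓖.EquivFun ρ) : 𝓖.EquivFun (homRep EG ρ) where
  toFun := 𝓖.fundDFun f
  smooth := fun _ => contMDiffAt_clm_of_apply fun X => contMDiff_fundDFun_apply f.smooth X _
  equivariant := fundDFun_act f

section Casimir

variable [LieAlgebra.IsSemisimple ℝ (LieAlg EG G)]

/-- The operator `(B ⊗ id) ∘ D²` on `C^∞(𝒢, W)^P`. -/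
def EquivFun.casimir (f : 𝓖.EquivFun ρ) : 𝓖.EquivFun ρ where
  toFun u := killingContract G (f.fundD.fundD u)
  smooth := by
    unfold killingContract
    refine ContMDiff.sum fun ℓ _ => ?_
    exact (f.fundD.fundD.smooth.clm_apply contMDiff_const).clm_apply contMDiff_const
  equivariant u h := by
    have h1 : killingContract G (f.fundD.fundD (𝓖.act u h)) = killingContract G
        (((ContinuousLinearMap.compL ℝ EG W W) (LinearMap.toContinuousLinearMap (ρ h⁻¹))).comp
          (f.fundD.fundD u)) := by
      refine killingContract_Ad (h : G) _ _ fun v w => ?_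
      rw [f.fundD.fundD.equivariant, homRep_apply, homRep_apply]
      simp
    rw [h1]
    unfold killingContract
    rw [map_sum]
    rfl

variable (𝓖 ρ) in
/-- The curved Casimir operator `𝒞 = (B ⊗ id) ∘ D² : Γ(WM) → Γ(WM)`. -/
def curvedCasimir [IsSmoothRep EP ρ] (σ : 𝓖.Sect ρ) : 𝓖.Sect ρ :=
  (𝓖.sectEquiv ρ).symm (𝓖.sectEquiv ρ σ).casimir

end Casimir

variable (𝓖 ρ) in
/-- The natural subbundle `W₀M = 𝒢 ×_P W₀ ⊂ WM` defined by an invariant subspace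
`W₀ ⊂ W`. -/
def subbundle (W₀ : Submodule ℝ W) : Set (𝓖.Assoc ρ) :=
  {a | ∃ u, ∃ w ∈ W₀, a = 𝓖.cls u w}

end CartanGeometry
end CartanGeometries

end CurvedCasimir

end

open scoped Manifold ContDiff

noncomputable section

namespace CurvedCasimir

namespace CartanGeometry

section Naturality

set_option linter.unusedSectionVars false

variable {EG EP EM EQ : Type*} [NormedAddCommGroup EG] [NormedSpace ℝ EG] [FiniteDimensional ℝ EG]
  [NormedAddCommGroup EP] [NormedSpace ℝ EP] [FiniteDimensional ℝ EP]
  [NormedAddCommGroup EM] [NormedSpace ℝ EM]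
  [NormedAddCommGroup EQ] [NormedSpace ℝ EQ] [FiniteDimensional ℝ EQ]
  {G : Type*} [TopologicalSpace G] [ChartedSpace EG G] [Group G] [LieGroup 𝓘(ℝ, EG) ∞ G]
  {P : Subgroup G} [ChartedSpace EP P] [LieGroup 𝓘(ℝ, EP) ∞ P]
  {M : Type*} [TopologicalSpace M] [ChartedSpace EM M] [IsManifold 𝓘(ℝ, EM) ∞ M]
  {Q : Type*} [TopologicalSpace Q] [ChartedSpace EQ Q] [IsManifold 𝓘(ℝ, EQ) ∞ Q]
  {𝓖 : CartanGeometry EG EP EM EQ P M Q}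
  {W : Type*} [NormedAddCommGroup W] [NormedSpace ℝ W] [FiniteDimensional ℝ W]
  {ρ : Representation ℝ P W}
  {W' : Type*} [NormedAddCommGroup W'] [NormedSpace ℝ W'] [FiniteDimensional ℝ W']
  {ρ' : Representation ℝ P W'}

/-! ### Sections and equivariant functions -/

/-! A section of a natural bundle is the same thing as an equivariant function on the total space
`Q`, and there the operator is built from two ingredients: differentiation along the fields
`ω⁻¹(X)`, and contraction of two `𝔤`-slots with the Killing form. Neither refers to the
representation beyond its vector space, so both commute with a fixed linear map between the values.
For the derivative this is the chain rule (`fundDFun_clm_comp`), for the contraction it is linearity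
(`killingContract_clm_comp`). Applying the chain rule twice gives `casimir_clm_comp`, which
translates back to naturality on sections, `curvedCasimir_sectMap`.

The other two claims are naturality for the inclusion `W₀ → W` and for the projection `W → W/W₀`.
For the inclusion it remains to identify sections with values in the subbundle with sections of the
bundle induced by `W₀`: existence is `exists_sectMap_subInclusion_eq`, uniqueness is
`sectMap_injective`.

For the projection, naturality shows that the operator of the quotient bundle has the required
property. That no other operator has it amounts to surjectivity of the projection on global smooth
sections, `sectMap_surjective`. This is the only global input: lifts are constructed in local
trivializations by a linear splitting and glued with a partition of unity on `M`. -/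

/-- `frameFun` is defined by choice. Since `P` acts freely on `Q`, the coordinate of a point of the
fibre in the frame `u` is unique, so any representative computes it. -/
lemma frameFun_eq {σ : 𝓖.Sect ρ} {u : Q} {w : W} (h : σ (𝓖.proj u) = 𝓖.cls u w) :
    σ.frameFun u = w :=
  𝓖.cls_injective ρ u ((Sect.eq_cls_frameFun σ u).symm.trans h)

/-- Moves identities between sections over `M` up to `Q`, where they become identities of
vector-valued functions. -/
lemma Sect.ext_frameFun {σ τ : 𝓖.Sect ρ} (h : ∀ u, σ.frameFun u = τ.frameFun u) : σ = τ := by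
  ext x
  obtain ⟨u, rfl⟩ := 𝓖.proj_surjective x
  rw [Sect.eq_cls_frameFun, Sect.eq_cls_frameFun, h]

lemma frameFun_toSect (f : 𝓖.EquivFun ρ) (u : Q) : f.toSect.frameFun u = f u :=
  frameFun_eq (f.toSect_proj u)

lemma frameFun_sectMap (Φ : ρ.IntertwiningMap ρ') (σ : 𝓖.Sect ρ) (u : Q) :
    (sectMap ρ' Φ σ).frameFun u = Φ (σ.frameFun u) := by
  apply frameFun_eq
  change bundleMap ρ' Φ (σ (𝓖.proj u)) = _
  rw [Sect.eq_cls_frameFun]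
  rfl

/-- Membership in `subbundle` only asks for some frame in which the coordinate lies in `W₀`. Another
frame over the same point changes the coordinate by an element of `P`, and invariance of `W₀` makes
the condition independent of the frame. -/
lemma mem_subbundle_iff {W₀ : Submodule ℝ W} (hW₀ : ∀ h, W₀ ≤ W₀.comap (ρ h)) (σ : 𝓖.Sect ρ)
    (u : Q) : σ (𝓖.proj u) ∈ 𝓖.subbundle ρ W₀ ↔ σ.frameFun u ∈ W₀ := by
  refine ⟨?_, fun h => ⟨u, _, h, Sect.eq_cls_frameFun σ u⟩⟩
  rintro ⟨v, w, hw, h⟩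
  rw [Sect.eq_cls_frameFun] at h
  obtain ⟨k, -, rfl⟩ := (𝓖.cls_eq_cls_iff ρ).1 h
  simpa using hW₀ k hw

/-! ### Naturality of the fundamental derivative -/

/-- Chain rule: a continuous linear map is its own derivative. No equivariance of `L` enters, so the
rule also applies to postcomposition maps on `L(𝔤, W)`. -/
lemma fundDFun_clm_comp (L : W →L[ℝ] W') {f : Q → W} (hf : ContMDiff 𝓘(ℝ, EQ) 𝓘(ℝ, W) ∞ f)
    (u : Q) : 𝓖.fundDFun (fun v => L (f v)) u = L.comp (𝓖.fundDFun f u) := by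
  have h := mfderiv_comp (I := 𝓘(ℝ, EQ)) (I' := 𝓘(ℝ, W)) (I'' := 𝓘(ℝ, W')) u
    L.mdifferentiableAt (hf.mdifferentiable (by simp) u)
  rw [ContinuousLinearMap.mfderiv_eq] at h
  ext X
  exact congrArg (fun T : EQ →L[ℝ] W' => T ((𝓖.connEquiv u).symm X)) h

/-! ### Naturality of the curved Casimir operator -/

section Casimir

variable [LieAlgebra.IsSemisimple ℝ (LieAlg EG G)]

lemma killingContract_clm_comp (L : W →L[ℝ] W') (T : EG →L[ℝ] EG →L[ℝ] W) :
    killingContract G ((ContinuousLinearMap.compL ℝ EG W W' L).comp T) =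
      L (killingContract G T) := by
  unfold killingContract
  rw [map_sum]
  rfl

/-- Only the pointwise relation between the two functions matters; `L` need not be an intertwining
map. -/
lemma casimir_clm_comp (L : W →L[ℝ] W') (f : 𝓖.EquivFun ρ) (g : 𝓖.EquivFun ρ')
    (h : ∀ u, g u = L (f u)) (u : Q) : g.casimir u = L (f.casimir u) := by
  have h0 : g.toFun = fun u => L (f u) := funext h
  have h1 : g.fundD.toFun = fun u => ContinuousLinearMap.compL ℝ EG W W' L (f.fundD u) := by
    funext u
    change 𝓖.fundDFun g.toFun u = _
    rw [h0, fundDFun_clm_comp L f.smooth]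
    rfl
  -- The same chain rule once more, now for functions with values in `L(𝔤, W)` and with
  -- postcomposition by `L` as the linear map.
  have h2 : g.fundD.fundD u =
      (ContinuousLinearMap.compL ℝ EG W W' L).comp (f.fundD.fundD u) := by
    change 𝓖.fundDFun g.fundD.toFun u = _
    rw [h1, fundDFun_clm_comp _ f.fundD.smooth]
    rfl
  change killingContract G (g.fundD.fundD u) = _
  rw [h2, killingContract_clm_comp]
  rfl

lemma frameFun_curvedCasimir [IsSmoothRep EP ρ] (σ : 𝓖.Sect ρ) (u : Q) :
    (𝓖.curvedCasimir ρ σ).frameFun u = σ.toEquivFun.casimir u :=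
  frameFun_toSect _ u

/-- The curved Casimir operator is natural with respect to homomorphisms of representations. -/
lemma curvedCasimir_sectMap [IsSmoothRep EP ρ] [IsSmoothRep EP ρ'] (Φ : ρ.IntertwiningMap ρ')
    (σ : 𝓖.Sect ρ) :
    𝓖.curvedCasimir ρ' (sectMap ρ' Φ σ) = sectMap ρ' Φ (𝓖.curvedCasimir ρ σ) := by
  refine Sect.ext_frameFun fun u => ?_
  rw [frameFun_sectMap, frameFun_curvedCasimir, frameFun_curvedCasimir]
  exact casimir_clm_comp (LinearMap.toContinuousLinearMap Φ.toLinearMap) _ _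
    (fun v => frameFun_sectMap Φ σ v) u

end Casimir

/-! ### Sections of subbundles -/

/-- Injectivity can be tested pointwise on coordinates in each frame. -/
lemma sectMap_injective (Φ : ρ.IntertwiningMap ρ') (hΦ : Function.Injective Φ) :
    Function.Injective (sectMap (𝓖 := 𝓖) ρ' Φ) := by
  intro σ τ h
  refine Sect.ext_frameFun fun u => hΦ ?_
  rw [← frameFun_sectMap, ← frameFun_sectMap, h]

/-- An equivariant function with values in the invariant subspace `W₀` is an equivariant function
to `W₀`. -/
def EquivFun.codRestrict (f : 𝓖.EquivFun ρ) (W₀ : Submodule ℝ W)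
    (hW₀ : ∀ h, W₀ ≤ W₀.comap (ρ h)) (hf : ∀ u, f u ∈ W₀) :
    𝓖.EquivFun (ρ.subrepresentation W₀ hW₀) where
  toFun u := ⟨f u, hf u⟩
  smooth := by
    -- A linear retraction `r : W → W₀` exhibits the restricted function as `r ∘ f`, hence smooth as
    -- a map into `W₀`.
    obtain ⟨r, hr⟩ := W₀.subtype.exists_leftInverse_of_injective (Submodule.ker_subtype W₀)
    refine ((LinearMap.toContinuousLinearMap r).contMDiff.comp f.smooth).congr fun u => ?_
    exact (congrArg (fun L : W₀ →ₗ[ℝ] W₀ => L ⟨f u, hf u⟩) hr).symm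
  equivariant u h := Subtype.ext (f.equivariant u h)

/-- Smoothness as a section of the smaller bundle is obtained on `Q`: there the section is a smooth
equivariant function with all values in `W₀`, and its codomain can be restricted. -/
lemma exists_sectMap_subInclusion_eq [IsSmoothRep EP ρ] (σ : 𝓖.Sect ρ) (W₀ : Submodule ℝ W)
    (hW₀ : ∀ h, W₀ ≤ W₀.comap (ρ h)) (hσ : ∀ x, σ x ∈ 𝓖.subbundle ρ W₀) :
    ∃ σ₀ : 𝓖.Sect (ρ.subrepresentation W₀ hW₀),
      sectMap ρ (subInclusion ρ W₀ hW₀) σ₀ = σ := by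
  refine ⟨(σ.toEquivFun.codRestrict W₀ hW₀ fun u =>
    (mem_subbundle_iff hW₀ σ u).1 (hσ _)).toSect, Sect.ext_frameFun fun u => ?_⟩
  rw [frameFun_sectMap, frameFun_toSect]
  rfl

lemma sectMap_subInclusion_mem (W₀ : Submodule ℝ W) (hW₀ : ∀ h, W₀ ≤ W₀.comap (ρ h))
    (σ₀ : 𝓖.Sect (ρ.subrepresentation W₀ hW₀)) (x : M) :
    sectMap ρ (subInclusion ρ W₀ hW₀) σ₀ x ∈ 𝓖.subbundle ρ W₀ := by
  obtain ⟨u, rfl⟩ := 𝓖.proj_surjective x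
  rw [mem_subbundle_iff hW₀, frameFun_sectMap]
  exact (σ₀.frameFun u).2

/-! ### Lifting sections of quotient bundles -/

/-- `IsSmoothRep` only asserts smoothness of the orbit maps of single vectors. As `W` is
finite-dimensional, this makes the operator-valued map smooth, so the group element and the vector
may vary together. -/
lemma contMDiffAt_smoothRep_apply [IsSmoothRep EP ρ] {k : Q → P} {f : Q → W} {u : Q}
    (hk : ContMDiffAt 𝓘(ℝ, EQ) 𝓘(ℝ, EP) ∞ k u) (hf : ContMDiffAt 𝓘(ℝ, EQ) 𝓘(ℝ, W) ∞ f u) :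
    ContMDiffAt 𝓘(ℝ, EQ) 𝓘(ℝ, W) ∞ (fun v => ρ (k v) (f v)) u := by
  have h : ContMDiffAt 𝓘(ℝ, EQ) 𝓘(ℝ, W →L[ℝ] W) ∞
      (fun v => LinearMap.toContinuousLinearMap (ρ (k v))) u :=
    contMDiffAt_clm_of_apply fun w =>
      (IsSmoothRep.contMDiff_apply (EP := EP) (ρ := ρ) w).contMDiffAt.comp u hk
  exact h.clm_apply hf

/-- Locally over `M`, an equivariant function lifts along a surjective homomorphism of
representations. -/
lemma exists_local_lift [IsSmoothRep EP ρ] [IsSmoothRep EP ρ'] (Φ : ρ.IntertwiningMap ρ')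
    (hΦ : Function.Surjective Φ) (f : 𝓖.EquivFun ρ') (x : M) :
    ∃ V : Set M, IsOpen V ∧ x ∈ V ∧ ∃ g : Q → W, ∀ u, 𝓖.proj u ∈ V →
      ContMDiffAt 𝓘(ℝ, EQ) 𝓘(ℝ, W) ∞ g u ∧ (∀ h, g (𝓖.act u h) = ρ h⁻¹ (g u)) ∧
        Φ (g u) = f u := by
  -- The splitting `r` is linear but in general not equivariant, so `r ∘ f` is not the desired lift.
  obtain ⟨r, hr⟩ := Φ.toLinearMap.exists_rightInverse_of_surjective
    (LinearMap.range_eq_top.2 hΦ)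
  have hr' : ∀ w, Φ (r w) = w := fun w => congrArg (fun L : W' →ₗ[ℝ] W' => L w) hr
  obtain ⟨e, hx, he1, -, he⟩ := 𝓖.exists_trivialization x
  -- Write `u = s(x) · k` with `k = (e u).2` and `s` the local section corresponding to `1 ∈ P`.
  -- Then `ρ' k (f u) = f(s(x))`, so the formula applies `r` only along `s` and extends
  -- equivariantly to the whole fibre.
  refine ⟨e.baseSet, e.open_baseSet, hx,
    fun u => ρ (e u).2⁻¹ (r (ρ' (e u).2 (f u))), fun u hu => ?_⟩
  have hu' : u ∈ e.source := e.mem_source.2 hu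
  refine ⟨?_, fun h => ?_, ?_⟩
  · have h1 : ContMDiffAt 𝓘(ℝ, EQ) 𝓘(ℝ, EP) ∞ (fun u => (e u).2) u :=
      contMDiffAt_snd.comp u (he1.contMDiffAt (e.open_source.mem_nhds hu'))
    have h2 : ContMDiffAt 𝓘(ℝ, EQ) 𝓘(ℝ, EP) ∞ (fun u => (e u).2⁻¹) u :=
      (contMDiff_inv 𝓘(ℝ, EP) ∞).contMDiffAt.comp u h1
    exact contMDiffAt_smoothRep_apply h2
      ((LinearMap.toContinuousLinearMap r).contMDiff.contMDiffAt.comp u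
        (contMDiffAt_smoothRep_apply h1 f.smooth.contMDiffAt))
  -- Passing from `u` to `u · h` replaces `k` by `k h`; in the argument of `r` the factor `h`
  -- cancels against the equivariance of `f`, and outside it leaves `ρ h⁻¹`.
  · simp only [he u hu' h, f.equivariant, map_mul, mul_inv_rev, Module.End.mul_apply,
      Representation.self_inv_apply]
  · rw [Representation.IntertwiningMap.isIntertwining, hr', Representation.inv_self_apply]

/-- On a paracompact base, equivariant functions lift along surjective homomorphisms of
representations. -/
lemma exists_lift [FiniteDimensional ℝ EM] [T2Space M] [SecondCountableTopology M]
    [IsSmoothRep EP ρ] [IsSmoothRep EP ρ'] (Φ : ρ.IntertwiningMap ρ')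
    (hΦ : Function.Surjective Φ) (f : 𝓖.EquivFun ρ') :
    ∃ g : 𝓖.EquivFun ρ, ∀ u, Φ (g u) = f u := by
  -- Together with second countability this gives σ-compactness, needed for the partition of unity.
  have : LocallyCompactSpace M := Manifold.locallyCompact_of_finiteDimensional 𝓘(ℝ, EM)
  choose V hVo hxV g hg using exists_local_lift (𝓖 := 𝓖) Φ hΦ f
  obtain ⟨φ, hφ⟩ := SmoothPartitionOfUnity.exists_isSubordinate 𝓘(ℝ, EM) (s := Set.univ)
    isClosed_univ V hVo fun x _ => Set.mem_iUnion.2 ⟨x, hxV x⟩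
  have hV : ∀ i x, φ i x ≠ 0 → x ∈ V i := fun i x h => hφ i (subset_tsupport _ h)
  have hfin : ∀ u, {i | φ i (𝓖.proj u) ≠ 0}.Finite := fun u => φ.locallyFinite.point_finite _
  have hfin' : ∀ u, (Function.support fun i => φ i (𝓖.proj u) • g i u).Finite := fun u =>
    (hfin u).subset fun i hi h => hi (by simp [h])
  -- The weights `φ i ∘ proj` are constant on `P`-orbits, so the weighted sum of the local lifts
  -- stays equivariant. As the weights add up to `1` and `Φ` is linear, it still lifts `f`.
  refine ⟨⟨fun u => ∑ᶠ i, φ i (𝓖.proj u) • g i u, ?_, fun u h => ?_⟩, fun u => ?_⟩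
  · refine contMDiff_finsum (fun i u => ?_) ?_
    · by_cases hu : 𝓖.proj u ∈ tsupport (φ i)
      · exact (((φ i).contMDiff.comp 𝓖.contMDiff_proj).contMDiffAt).smul (hg i u (hφ i hu)).1
      -- Outside `V i` nothing is known about `g i`, but off the closed support of `φ i` the summand
      -- vanishes in a neighbourhood.
      · refine (contMDiffAt_const (c := (0 : W))).congr_of_eventuallyEq ?_
        have h1 := 𝓖.contMDiff_proj.continuous.continuousAt.preimage_mem_nhds
          ((isClosed_tsupport (φ i)).isOpen_compl.mem_nhds hu)
        filter_upwards [h1] with v hv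
        rw [image_eq_zero_of_notMem_tsupport hv, zero_smul]
    · exact (φ.locallyFinite.preimage_continuous 𝓖.contMDiff_proj.continuous).subset
        fun i u hu h => hu (by simp [h])
  · rw [map_finsum _ (hfin' u)]
    refine finsum_congr fun i => ?_
    rw [𝓖.proj_act, map_smul]
    by_cases h0 : φ i (𝓖.proj u) = 0
    · simp [h0]
    · rw [(hg i u (hV i _ h0)).2.1]
  · change Φ (∑ᶠ i, φ i (𝓖.proj u) • g i u) = f u
    rw [map_finsum Φ (hfin' u)]
    calc ∑ᶠ i, Φ (φ i (𝓖.proj u) • g i u) = ∑ᶠ i, φ i (𝓖.proj u) • f u := by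
          refine finsum_congr fun i => ?_
          rw [map_smul]
          by_cases h0 : φ i (𝓖.proj u) = 0
          · simp [h0]
          · rw [(hg i u (hV i _ h0)).2.2]
      _ = f u := by
          rw [← finsum_smul, φ.sum_eq_one (Set.mem_univ _), one_smul]

lemma sectMap_surjective [FiniteDimensional ℝ EM] [T2Space M] [SecondCountableTopology M]
    [IsSmoothRep EP ρ] [IsSmoothRep EP ρ'] (Φ : ρ.IntertwiningMap ρ')
    (hΦ : Function.Surjective Φ) : Function.Surjective (sectMap (𝓖 := 𝓖) ρ' Φ) := by
  intro τ
  obtain ⟨g, hg⟩ := exists_lift Φ hΦ τ.toEquivFun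
  refine ⟨g.toSect, Sect.ext_frameFun fun u => ?_⟩
  rw [frameFun_sectMap, frameFun_toSect, hg]
  rfl

end Naturality

end CartanGeometry

end CurvedCasimir

end

open CurvedCasimir CurvedCasimir.CartanGeometry in
theorem proposition3p1
    -- the semisimple Lie group `G` and the parabolic subgroup `P`
    {EG EP : Type*} [NormedAddCommGroup EG] [NormedSpace ℝ EG] [FiniteDimensional ℝ EG]
    [NormedAddCommGroup EP] [NormedSpace ℝ EP] [FiniteDimensional ℝ EP]
    {G : Type*} [TopologicalSpace G] [ChartedSpace EG G] [Group G] [LieGroup 𝓘(ℝ, EG) ∞ G]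
    [LieAlgebra.IsSemisimple ℝ (LieAlg EG G)]
    (P : Subgroup G) [ChartedSpace EP P] [LieGroup 𝓘(ℝ, EP) ∞ P]
    (hP : IsParabolicSubgroup EG EP P)
    -- the parabolic geometry `(p : 𝒢 → M, ω)` of type `(G, P)`
    {EM EQ : Type*} [NormedAddCommGroup EM] [NormedSpace ℝ EM] [FiniteDimensional ℝ EM]
    [NormedAddCommGroup EQ] [NormedSpace ℝ EQ] [FiniteDimensional ℝ EQ]
    {M : Type*} [TopologicalSpace M] [ChartedSpace EM M] [IsManifold 𝓘(ℝ, EM) ∞ M]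
    [T2Space M] [SecondCountableTopology M]
    {Q : Type*} [TopologicalSpace Q] [ChartedSpace EQ Q] [IsManifold 𝓘(ℝ, EQ) ∞ Q]
    (𝓖 : CartanGeometry EG EP EM EQ P M Q)
    -- the representations `W` and `W'` of `P`
    {W W' : Type*} [NormedAddCommGroup W] [NormedSpace ℝ W] [FiniteDimensional ℝ W]
    [NormedAddCommGroup W'] [NormedSpace ℝ W'] [FiniteDimensional ℝ W']
    (ρ : Representation ℝ P W) [IsSmoothRep EP ρ]
    (ρ' : Representation ℝ P W') [IsSmoothRep EP ρ'] :
    -- naturality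
    (∀ (Φ : ρ.IntertwiningMap ρ') (σ : 𝓖.Sect ρ),
      𝓖.curvedCasimir ρ' (sectMap ρ' Φ σ) = sectMap ρ' Φ (𝓖.curvedCasimir ρ σ)) ∧
    ∀ (W₀ : Submodule ℝ W) (hW₀ : ∀ h, W₀ ≤ W₀.comap (ρ h)),
      -- the operator preserves sections of the natural subbundle, and restricts to its operator
      (∀ σ : 𝓖.Sect ρ, (∀ x, σ x ∈ 𝓖.subbundle ρ W₀) →
        (∀ x, 𝓖.curvedCasimir ρ σ x ∈ 𝓖.subbundle ρ W₀) ∧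
        ∃! σ₀ : 𝓖.Sect (ρ.subrepresentation W₀ hW₀),
          sectMap ρ (subInclusion ρ W₀ hW₀) σ₀ = σ ∧
          sectMap ρ (subInclusion ρ W₀ hW₀)
            (𝓖.curvedCasimir (ρ.subrepresentation W₀ hW₀) σ₀) = 𝓖.curvedCasimir ρ σ) ∧
      -- there is exactly one induced operator on sections of the natural quotient bundle, namely
      -- the curved Casimir operator of that bundle
      (∀ T : 𝓖.Sect (ρ.quotient W₀ hW₀) → 𝓖.Sect (ρ.quotient W₀ hW₀),
        (∀ σ : 𝓖.Sect ρ, T (sectMap (ρ.quotient W₀ hW₀) (quotientProj ρ W₀ hW₀) σ) =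
          sectMap (ρ.quotient W₀ hW₀) (quotientProj ρ W₀ hW₀) (𝓖.curvedCasimir ρ σ)) ↔
        T = 𝓖.curvedCasimir (ρ.quotient W₀ hW₀)) := by
  refine ⟨fun Φ σ => curvedCasimir_sectMap Φ σ, fun W₀ hW₀ => ⟨fun σ hσ => ?_, fun T => ⟨?_, ?_⟩⟩⟩
  · obtain ⟨σ₀, rfl⟩ := exists_sectMap_subInclusion_eq σ W₀ hW₀ hσ
    have h := curvedCasimir_sectMap (subInclusion ρ W₀ hW₀) σ₀
    refine ⟨fun x => ?_, σ₀, ⟨rfl, h.symm⟩, fun τ hτ => ?_⟩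
    · rw [h]
      exact sectMap_subInclusion_mem W₀ hW₀ _ x
    -- The first of the two conditions already determines the section.
    · exact sectMap_injective _ Subtype.val_injective hτ.1
  · intro hT
    funext τ
    -- Every section of the quotient bundle is the projection of a section of `WM`, on which the
    -- value of `T` is prescribed.
    obtain ⟨σ, rfl⟩ := sectMap_surjective (quotientProj ρ W₀ hW₀) W₀.mkQ_surjective τ
    rw [hT, curvedCasimir_sectMap]
  · rintro rfl σ
    exact curvedCasimir_sectMap _ σ
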